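/- Let $\mathbb{F}_q$ be the finite field with $q$ elements and let $n$ be a natural number. For a monic polynomial $p=p_0+p_1x+\dots+p_{d-1}x^{d-1}+x^d\in\mathbb{F}_q[x]$ let $M_p\in\mathbb{F}_q^{d\times d}$ be its companion matrix (ones on the superdiagonal, last row $(-p_0,\dots,-p_{d-1})$, zeros elsewhere), and for $p(0)\neq 0$ let the order of $p$ be the least positive integer $k$ such that $p$ divides $x^k-1$. Every $A\in\mathrm{GL}_n(\mathbb{F}_q)$ has a rational canonical form: there are distinct monic irreducible polynomials $p_1,\dots,p_m\in\mathbb{F}_q[x]$, integer partitions $e_i=(e_{i,1}\ge\dots\ge e_{i,r_i}\geq 1)$ with $r_i\ge 1$ ($1\le i\le m$), and $L\in \mathrm{GL}_n(\mathbb{F}_q)$ such that $$L^{-1}AL=\mathrm{diag}\bigl(M_{p_1^{e_{1,1}}},\dots,M_{p_1^{e_{1,r_1}}},\dots,M_{p_m^{e_{m,1}}},\dots,M_{p_m^{e_{m,r_m}}}\bigr).$$ Let $o_i$ be the order of $p_i$, and number the polynomials so that the partitions $e_1,\dots,e_m$ are in lexicographically increasing order and, among equal partitions, the orders $o_i$ are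 increasing. The matrix type of $A$ is the pair $(e(A),o(A))$, where $e(A):=(e_1,\dots,e_m)$ and $o(A):=(o_1,\dots,o_m)$. Then every $A\in\mathrm{GL}_n(\mathbb{F}_q)$ has exactly one matrix type, and the matrix type is constant on the set of all generators of the same cyclic group: for all $A,B\in\mathrm{GL}_n(\mathbb{F}_q)$, $$\langle A\rangle=\langle B\rangle\ \Longrightarrow\ e(A)=e(B)\ \text{ and }\ o(A)=o(B).$$ -/

import Mathlib

open Polynomial

namespace CyclicOrbit

/-- The companion matrix of `p = p₀ + p₁ x + ⋯ + p_{d-1} x^{d-1} + x^d` (meant for monic `p`):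
ones on the superdiagonal, last row `(-p₀, …, -p_{d-1})`, and zeros elsewhere. -/
def companionMatrix {F : Type*} [Field F] (p : F[X]) :
    Matrix (Fin p.natDegree) (Fin p.natDegree) F :=
  Matrix.of fun i j =>
    if (i : ℕ) + 1 = p.natDegree then -p.coeff j
    else if (i : ℕ) + 1 = j then 1 else 0

/-- The order of a polynomial `p` with `p(0) ≠ 0`: the least positive integer `k` such that
`p` divides `x ^ k - 1`. -/
noncomputable def polyOrder {F : Type*} [Field F] (p : F[X]) : ℕ :=
  sInf {k : ℕ | 0 < k ∧ p ∣ X ^ k - 1}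

/-- An integer partition `(e₁ ≥ ⋯ ≥ e_r)` of a natural number `≥ 1`, as a list of its parts. -/
def IsPartition (l : List ℕ) : Prop :=
  l ≠ [] ∧ (∀ k ∈ l, 0 < k) ∧ l.Pairwise (· ≥ ·)

/-- The parameters `(p₁, …, p_m)` and `(e₁, …, e_m)` of a rational canonical form: distinct monic
irreducible polynomials and integer partitions. -/
structure RCFData (F : Type*) [Field F] where
  /-- the number of irreducible polynomials -/
  m : ℕ
  /-- the irreducible polynomials -/
  p : Fin m → F[X]
  /-- the partitions -/
  e : Fin m → List ℕ
  p_injective : Function.Injective p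
  p_monic : ∀ i, (p i).Monic
  p_irreducible : ∀ i, Irreducible (p i)
  e_partition : ∀ i, IsPartition (e i)

namespace RCFData

variable {F : Type*} [Field F]

/-- The positions `(i, j)` of the diagonal blocks, `j` running over the parts of `e i`. -/
abbrev Block (D : RCFData F) : Type := Σ i : Fin D.m, Fin (D.e i).length

/-- The elementary divisor `p_i ^ e_{i,j}`. -/
noncomputable def elementaryDivisor (D : RCFData F) (b : D.Block) : F[X] :=
  D.p b.1 ^ (D.e b.1).get b.2

/-- The row (and column) indices: a block together with a position inside the block. -/
abbrev Index (D : RCFData F) : Type :=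
  Σ b : D.Block, Fin (D.elementaryDivisor b).natDegree

/-- The block diagonal matrix whose diagonal blocks are the companion matrices of the
elementary divisors `p_i ^ e_{i,j}`. -/
noncomputable def matrix (D : RCFData F) : Matrix D.Index D.Index F :=
  Matrix.blockDiagonal' fun b => companionMatrix (D.elementaryDivisor b)

end RCFData

/-- `D` gives a rational canonical form of `A`: for some `L ∈ GL_n`, the matrix `L⁻¹ A L` is the
block diagonal matrix of `D`. The bijection `σ` names the row and column indices by
`0, …, n - 1`; changing it conjugates by a permutation matrix, which `L` absorbs. -/
def IsRCF {F : Type*} [Field F] {n : ℕ} (A : GL (Fin n) F) (D : RCFData F) : Prop :=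
  ∃ (σ : D.Index ≃ Fin n) (L : GL (Fin n) F),
    ((L⁻¹ * A * L : GL (Fin n) F) : Matrix (Fin n) (Fin n) F) = Matrix.reindex σ σ D.matrix

/-- `T = ((e₁, …, e_m), (o₁, …, o_m))` is a matrix type of `A`: it is read off from a rational
canonical form of `A` whose polynomials are listed so that the partitions increase
lexicographically and, among equal partitions, the orders `o_i` of the `p_i` increase. -/
def HasMatrixType {F : Type*} [Field F] {n : ℕ} (A : GL (Fin n) F)
    (T : List (List ℕ) × List ℕ) : Prop :=
  ∃ D : RCFData F, IsRCF A D ∧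
    Monotone (fun i : Fin D.m => toLex (D.e i, polyOrder (D.p i))) ∧
    T = (List.ofFn D.e, List.ofFn fun i => polyOrder (D.p i))

/-- The matrix type `(e(A), o(A))` of `A`. -/
noncomputable def matrixType {F : Type*} [Field F] {n : ℕ} (A : GL (Fin n) F) :
    List (List ℕ) × List ℕ :=
  Classical.epsilon (HasMatrixType A)

/-- The vector `e(A)` of partitions. -/
noncomputable def typePartitions {F : Type*} [Field F] {n : ℕ} (A : GL (Fin n) F) :
    List (List ℕ) :=
  (matrixType A).1

/-- The vector `o(A)` of orders. -/
noncomputable def typeOrders {F : Type*} [Field F] {n : ℕ} (A : GL (Fin n) F) : List ℕ :=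
  (matrixType A).2

end CyclicOrbit

/-! If `⟨A⟩ = ⟨B⟩`, finiteness of the group makes each of `A`, `B` a positive or zero power of the
other, so both generate the same commutative algebra `R = F[A] = F[B]`, acting faithfully on `V =
F^n`. The type can be read off from `R` acting on `V`. The maximal ideals of `R` are the distinct
`I_i = (p_i(A))`. The dimension of the `I_i ^ k`-torsion of `V` is `deg p_i * ∑ j, min k e_{i,j}`,
where `deg p_i = dim R/I_i`; these numbers determine `e_i`. The order `o_i` is the least `k > 0`
with `A ^ k - 1 ∈ I_i`, unchanged when `A` is replaced by `B`. Matching maximal ideals therefore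
matches the pairs `(e_i, o_i)` (`Presents.exists_equiv`), and sorting makes the lists equal.
Uniqueness is the case `A = B`.

Existence is the structure theorem over `F[X]` (`exists_presents`). `IsRCF.presents` and
`Presents.isRCF` translate between matrices and modules. -/

namespace CyclicOrbit

namespace RCFData

variable {F : Type*} [Field F] (D : RCFData F)

/-- The `F[X]`-module presented by the elementary divisors of `D`. -/
abbrev Model : Type _ := ∀ b : D.Block, AdjoinRoot (D.elementaryDivisor b)

lemma elementaryDivisor_monic (b : D.Block) : (D.elementaryDivisor b).Monic :=
  (D.p_monic b.1).pow _

lemma exists_block (i : Fin D.m) : ∃ b : D.Block, b.1 = i :=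
  ⟨⟨i, ⟨0, List.length_pos_iff.2 (D.e_partition i).1⟩⟩, rfl⟩

lemma dvd_elementaryDivisor (b : D.Block) : D.p b.1 ∣ D.elementaryDivisor b :=
  dvd_pow_self _ ((D.e_partition b.1).2.1 _ (List.get_mem _ _)).ne'

end RCFData

/-- The operator `T` on `V` is isomorphic to multiplication by `X` on the module presented by
the elementary divisors of `D`. -/
def Presents {F V : Type*} [Field F] [AddCommGroup V] [Module F V] (T : V → V)
    (D : RCFData F) : Prop :=
  ∃ φ : V ≃ₗ[F] D.Model, ∀ v b, φ (T v) b = AdjoinRoot.root _ * φ v b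

/-! ### Kernel dimensions in cyclic modules, and recovering a partition -/

lemma finrank_ker_mulLeft {F : Type*} [Field F] {q r g : F[X]} (hq : q ≠ 0)
    (hg : Ideal.span {q, r} = Ideal.span {g}) :
    Module.finrank F (LinearMap.ker (LinearMap.mulLeft F (AdjoinRoot.mk q r))) =
      g.natDegree := by
  have hgq : g ∣ q := by
    rw [← Ideal.mem_span_singleton, ← hg]
    exact Ideal.subset_span (by simp)
  have : Module.Finite F (AdjoinRoot q) := (AdjoinRoot.powerBasis hq).finite
  let π : AdjoinRoot q →ₗ[F] AdjoinRoot g :=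
    (AdjoinRoot.liftAlgHom q (Algebra.ofId F _) (AdjoinRoot.root g) (by
      obtain ⟨s, rfl⟩ := hgq
      change eval₂ (AdjoinRoot.of g) _ _ = 0
      rw [eval₂_mul, AdjoinRoot.eval₂_root, zero_mul])).toLinearMap
  have hπ (s : F[X]) : π (AdjoinRoot.mk q s) = AdjoinRoot.mk g s := by
    change eval₂ (AdjoinRoot.of g) (AdjoinRoot.root g) s = _
    exact AdjoinRoot.aeval_eq s
  have hsurj : LinearMap.range π = ⊤ := by
    rw [LinearMap.range_eq_top]
    intro x
    obtain ⟨s, rfl⟩ := AdjoinRoot.mk_surjective x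
    exact ⟨_, hπ s⟩
  have hker : LinearMap.range (LinearMap.mulLeft F (AdjoinRoot.mk q r)) = LinearMap.ker π := by
    ext x
    obtain ⟨s, rfl⟩ := AdjoinRoot.mk_surjective x
    rw [LinearMap.mem_ker, hπ, AdjoinRoot.mk_eq_zero, ← Ideal.mem_span_singleton, ← hg,
      Ideal.mem_span_pair, LinearMap.mem_range]
    constructor
    · rintro ⟨y, hy⟩
      obtain ⟨t, rfl⟩ := AdjoinRoot.mk_surjective y
      rw [LinearMap.mulLeft_apply, ← map_mul, AdjoinRoot.mk_eq_mk] at hy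
      obtain ⟨u, hu⟩ := hy
      exact ⟨-u, t, by linear_combination hu⟩
    · rintro ⟨u, t, rfl⟩
      exact ⟨AdjoinRoot.mk q t, by simp [mul_comm]⟩
  have h1 := LinearMap.finrank_range_add_finrank_ker (LinearMap.mulLeft F (AdjoinRoot.mk q r))
  have h2 := LinearMap.finrank_range_add_finrank_ker π
  rw [hsurj, finrank_top] at h2
  rw [hker] at h1
  have h3 : Module.finrank F (AdjoinRoot g) = g.natDegree := finrank_quotient_span_eq_natDegree
  omega

lemma sum_map_min_succ (l : List ℕ) (k : ℕ) :
    (l.map (min (k + 1))).sum = (l.map (min k)).sum + l.countP (k < ·) := by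
  induction l with
  | nil => simp
  | cons x l ih =>
    simp only [List.map_cons, List.sum_cons, ih, List.countP_cons, decide_eq_true_eq]
    split_ifs <;> omega

lemma countP_lt_eq_add_count (l : List ℕ) (k : ℕ) :
    l.countP (k < ·) = l.countP (k + 1 < ·) + l.count (k + 1) := by
  induction l with
  | nil => simp
  | cons x l ih =>
    simp only [List.countP_cons, List.count_cons, decide_eq_true_eq, beq_iff_eq]
    split_ifs <;> omega

/-- The first difference in `k` of the sums counts the parts exceeding `k`; the second difference
gives the multiplicity of each part. -/
lemma IsPartition.eq_of_sum_map_min {l l' : List ℕ} (hl : IsPartition l) (hl' : IsPartition l')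
    (h : ∀ k, (l.map (min k)).sum = (l'.map (min k)).sum) : l = l' := by
  have hc (k : ℕ) : l.countP (k < ·) = l'.countP (k < ·) := by
    have h1 := sum_map_min_succ l k
    have h2 := sum_map_min_succ l' k
    have := h k
    have := h (k + 1)
    omega
  have hp : l.Perm l' := by
    rw [List.perm_iff_count]
    rintro (_ | k)
    · rw [List.count_eq_zero.2 fun h => (hl.2.1 _ h).ne rfl,
        List.count_eq_zero.2 fun h => (hl'.2.1 _ h).ne rfl]
    · have h1 := countP_lt_eq_add_count l k
      have h2 := countP_lt_eq_add_count l' k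
      have := hc k
      have := hc (k + 1)
      omega
  exact hp.eq_of_pairwise' hl.2.2 hl'.2.2

/-! ### Invariants of the algebra generated by the operator -/

section Invariants

variable {F R V : Type*} [Field F] [CommRing R] [Algebra F R] [AddCommGroup V] [Module F V]
  [Module R V] [IsScalarTower F R V] {a : R} {D : RCFData F}

lemma RCFData.Model.map_aeval_smul {φ : V ≃ₗ[F] D.Model}
    (hφ : ∀ v b, φ (a • v) b = AdjoinRoot.root _ * φ v b) (q : F[X]) (v : V) (b : D.Block) :
    φ (aeval a q • v) b = AdjoinRoot.mk _ q * φ v b := by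
  induction q using Polynomial.induction_on' generalizing v with
  | add q r hq hr => simp [add_smul, hq, hr, add_mul]
  | monomial k c =>
    induction k generalizing v with
    | zero =>
      rw [monomial_zero_left, aeval_C, algebraMap_smul, map_smul, Pi.smul_apply, Algebra.smul_def,
        AdjoinRoot.mk_C]
      rfl
    | succ k ih =>
      rw [← monomial_mul_X, map_mul, aeval_X, mul_smul, ih, hφ, map_mul, AdjoinRoot.mk_X, mul_assoc]

lemma RCFData.dvd_of_aeval_eq_zero {φ : V ≃ₗ[F] D.Model}
    (hφ : ∀ v b, φ (a • v) b = AdjoinRoot.root _ * φ v b) {q : F[X]} (hq : aeval a q = 0)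
    (b : D.Block) : D.elementaryDivisor b ∣ q := by
  -- The vector with all coordinates `1` generates every block.
  have h := RCFData.Model.map_aeval_smul hφ q (φ.symm 1) b
  rw [hq, zero_smul, map_zero, LinearEquiv.apply_symm_apply] at h
  simpa using h.symm

lemma RCFData.aeval_prod_eq_zero [FaithfulSMul R V] {φ : V ≃ₗ[F] D.Model}
    (hφ : ∀ v b, φ (a • v) b = AdjoinRoot.root _ * φ v b) :
    aeval a (∏ b, D.elementaryDivisor b) = 0 := by
  refine FaithfulSMul.eq_of_smul_eq_smul (α := V) fun v => φ.injective ?_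
  ext b
  rw [RCFData.Model.map_aeval_smul hφ, AdjoinRoot.mk_eq_zero.2
    (Finset.dvd_prod_of_mem _ (Finset.mem_univ b))]
  simp

/-- The ideal of `R` generated by `p_i(a)`. -/
noncomputable def RCFData.ideal (D : RCFData F) (a : R) (i : Fin D.m) : Ideal R :=
  Ideal.span {aeval a (D.p i)}

/-- A polynomial killing `a` is divisible by every elementary divisor, hence by `p_i`; so lifting an
equation from `R` to `F[X]` costs only a multiple of `p_i`. -/
lemma RCFData.aeval_mem_ideal_iff {φ : V ≃ₗ[F] D.Model}
    (hφ : ∀ v b, φ (a • v) b = AdjoinRoot.root _ * φ v b)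
    (ha : Function.Surjective (aeval (R := F) a)) (i : Fin D.m) {q : F[X]} :
    aeval a q ∈ D.ideal a i ↔ D.p i ∣ q := by
  rw [RCFData.ideal, Ideal.mem_span_singleton]
  refine ⟨fun ⟨r, hr⟩ => ?_, map_dvd _⟩
  obtain ⟨s, rfl⟩ := ha r
  obtain ⟨b, rfl⟩ := D.exists_block i
  have h := (D.dvd_elementaryDivisor b).trans (RCFData.dvd_of_aeval_eq_zero hφ
    (q := q - D.p b.1 * s) (by rw [map_sub, hr, map_mul, sub_self]) b)
  simpa using dvd_add h (dvd_mul_right (D.p b.1) s)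

lemma RCFData.ideal_isMaximal {φ : V ≃ₗ[F] D.Model}
    (hφ : ∀ v b, φ (a • v) b = AdjoinRoot.root _ * φ v b)
    (ha : Function.Surjective (aeval (R := F) a)) (i : Fin D.m) : (D.ideal a i).IsMaximal := by
  have hmax : (Ideal.span {D.p i}).IsMaximal :=
    PrincipalIdealRing.isMaximal_of_irreducible (D.p_irreducible i)
  have h := Ideal.map_eq_top_or_isMaximal_of_surjective (aeval (R := F) a) ha hmax
  rw [Ideal.map_span, Set.image_singleton] at h
  refine h.resolve_left fun h => (D.p_irreducible i).not_isUnit ?_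
  rw [isUnit_iff_dvd_one, ← RCFData.aeval_mem_ideal_iff hφ ha, RCFData.ideal, h]
  trivial

lemma RCFData.ideal_injective {φ : V ≃ₗ[F] D.Model}
    (hφ : ∀ v b, φ (a • v) b = AdjoinRoot.root _ * φ v b)
    (ha : Function.Surjective (aeval (R := F) a)) : Function.Injective (D.ideal a) := by
  intro i j hij
  have h : D.p i ∣ D.p j := by
    rw [← RCFData.aeval_mem_ideal_iff hφ ha, hij]
    exact Ideal.mem_span_singleton_self _
  exact D.p_injective (eq_of_monic_of_associated (D.p_monic i) (D.p_monic j)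
    ((D.p_irreducible i).associated_of_dvd (D.p_irreducible j) h))

/-- The product of the elementary divisors vanishes at `a`, so a prime ideal must contain some
`p_i(a)`. -/
lemma RCFData.exists_ideal_eq [FaithfulSMul R V] {φ : V ≃ₗ[F] D.Model}
    (hφ : ∀ v b, φ (a • v) b = AdjoinRoot.root _ * φ v b)
    (ha : Function.Surjective (aeval (R := F) a)) {I : Ideal R} (hI : I.IsMaximal) :
    ∃ i, D.ideal a i = I := by
  have h : aeval a (∏ b, D.elementaryDivisor b) ∈ I := by
    rw [RCFData.aeval_prod_eq_zero hφ]
    exact I.zero_mem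
  rw [map_prod, hI.isPrime.prod_mem_iff] at h
  obtain ⟨b, -, hb⟩ := h
  refine ⟨b.1, (RCFData.ideal_isMaximal hφ ha b.1).eq_of_le hI.ne_top ?_⟩
  rw [RCFData.ideal, Ideal.span_singleton_le_iff_mem]
  rw [RCFData.elementaryDivisor, map_pow] at hb
  exact hI.isPrime.mem_of_pow_mem _ hb

lemma RCFData.finrank_quotient_ideal {φ : V ≃ₗ[F] D.Model}
    (hφ : ∀ v b, φ (a • v) b = AdjoinRoot.root _ * φ v b)
    (ha : Function.Surjective (aeval (R := F) a)) (i : Fin D.m) :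
    Module.finrank F (R ⧸ D.ideal a i) = (D.p i).natDegree := by
  let f : F[X] →ₐ[F] R ⧸ D.ideal a i := (Ideal.Quotient.mkₐ F (D.ideal a i)).comp (aeval a)
  have hf : Function.Surjective f := (Ideal.Quotient.mkₐ_surjective F _).comp ha
  have hker : RingHom.ker f = Ideal.span {D.p i} := by
    ext q
    rw [RingHom.mem_ker, Ideal.mem_span_singleton, ← RCFData.aeval_mem_ideal_iff hφ ha]
    exact Ideal.Quotient.eq_zero_iff_mem
  rw [← ((Ideal.quotientEquivAlgOfEq F hker).symm.trans
    (Ideal.quotientKerAlgEquivOfSurjective hf)).toLinearEquiv.finrank_eq]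
  exact finrank_quotient_span_eq_natDegree

lemma RCFData.finrank_torsion {φ : V ≃ₗ[F] D.Model}
    (hφ : ∀ v b, φ (a • v) b = AdjoinRoot.root _ * φ v b) (q : F[X]) :
    Module.finrank F (Submodule.torsionBy R V (aeval a q)) =
      ∑ b, Module.finrank F
        (LinearMap.ker (LinearMap.mulLeft F (AdjoinRoot.mk (D.elementaryDivisor b) q))) := by
  have (b : D.Block) : Module.Finite F (AdjoinRoot (D.elementaryDivisor b)) :=
    (D.elementaryDivisor_monic b).finite_adjoinRoot
  rw [← Module.finrank_pi_fintype]
  have hmem (v : V) (b : D.Block) (hv : v ∈ Submodule.torsionBy R V (aeval a q)) :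
      φ v b ∈ LinearMap.ker (LinearMap.mulLeft F (AdjoinRoot.mk (D.elementaryDivisor b) q)) := by
    rw [Submodule.mem_torsionBy_iff] at hv
    rw [LinearMap.mem_ker, LinearMap.mulLeft_apply, ← RCFData.Model.map_aeval_smul hφ, hv,
      map_zero, Pi.zero_apply]
  refine LinearEquiv.finrank_eq
    { toFun v b := ⟨φ v b, hmem v b v.2⟩
      invFun w := ⟨φ.symm fun b => w b, ?_⟩
      map_add' v w := by ext; simp
      map_smul' c v := by ext; simp
      left_inv v := by simp
      right_inv w := by simp }
  rw [Submodule.mem_torsionBy_iff]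
  refine φ.injective (funext fun b => ?_)
  rw [RCFData.Model.map_aeval_smul hφ, LinearEquiv.apply_symm_apply, map_zero]
  exact (w b).2

/-- A block `p_i ^ e` contributes the degree of `gcd(p_i ^ e, p_i ^ k)`; blocks of other
irreducibles are coprime to `p_i` and contribute nothing. -/
lemma RCFData.finrank_torsion_ideal_pow {φ : V ≃ₗ[F] D.Model}
    (hφ : ∀ v b, φ (a • v) b = AdjoinRoot.root _ * φ v b) (i : Fin D.m) (k : ℕ) :
    Module.finrank F (Submodule.torsionBySet R V (D.ideal a i ^ k : Ideal R)) =
      ((D.e i).map (min k)).sum * (D.p i).natDegree := by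
  rw [RCFData.ideal, Ideal.span_singleton_pow, ← map_pow,
    Submodule.torsionBySet_span_singleton_eq, RCFData.finrank_torsion hφ, Fintype.sum_sigma,
    Finset.sum_eq_single i]
  · rw [← Fin.sum_univ_fun_getElem, Finset.sum_mul]
    refine Finset.sum_congr rfl fun j _ => ?_
    rw [finrank_ker_mulLeft (g := D.p i ^ min k ((D.e i).get j))
      (D.elementaryDivisor_monic _).ne_zero, natDegree_pow]
    · simp
    · rw [RCFData.elementaryDivisor, Ideal.span_insert]
      rcases le_total k ((D.e i).get j) with h | h
      · rw [min_eq_left h, sup_eq_right, Ideal.span_singleton_le_span_singleton]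
        exact pow_dvd_pow _ h
      · rw [min_eq_right h, sup_eq_left, Ideal.span_singleton_le_span_singleton]
        exact pow_dvd_pow _ h
  · intro i' _ hi'
    refine Finset.sum_eq_zero fun j _ => ?_
    rw [finrank_ker_mulLeft (g := 1) (D.elementaryDivisor_monic _).ne_zero, natDegree_one]
    rw [Ideal.span_singleton_one, Ideal.span_insert, ← Ideal.isCoprime_iff_sup_eq,
      Ideal.isCoprime_span_singleton_iff]
    refine IsCoprime.pow (((D.p_irreducible i').coprime_iff_not_dvd).2 fun h => hi' ?_)
    exact D.p_injective (eq_of_monic_of_associated (D.p_monic i') (D.p_monic i)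
      ((D.p_irreducible i').associated_of_dvd (D.p_irreducible i) h))
  · simp

lemma RCFData.polyOrder_eq {φ : V ≃ₗ[F] D.Model}
    (hφ : ∀ v b, φ (a • v) b = AdjoinRoot.root _ * φ v b)
    (ha : Function.Surjective (aeval (R := F) a)) (i : Fin D.m) :
    polyOrder (D.p i) = sInf {k | 0 < k ∧ a ^ k - 1 ∈ D.ideal a i} := by
  have h (k : ℕ) : aeval a (X ^ k - 1 : F[X]) = a ^ k - 1 := by simp
  simp_rw [← h, RCFData.aeval_mem_ideal_iff hφ ha]
  rfl

lemma pow_pow_sub_one_mem {I : Ideal R} {a : R} {k : ℕ} (s : ℕ) (h : a ^ k - 1 ∈ I) :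
    (a ^ s) ^ k - 1 ∈ I := by
  rw [← pow_mul, mul_comm, pow_mul]
  exact I.mem_of_dvd (sub_one_dvd_pow_sub_one _ _) h

theorem Presents.exists_equiv [FaithfulSMul R V] {b : R} {s t : ℕ} (hb : b = a ^ s) (hab : a = b ^ t)
    (ha : Function.Surjective (aeval (R := F) a)) {D' : RCFData F}
    (h : Presents (fun v : V => a • v) D) (h' : Presents (fun v : V => b • v) D') :
    ∃ σ : Fin D.m ≃ Fin D'.m, ∀ i,
      D'.e (σ i) = D.e i ∧ polyOrder (D'.p (σ i)) = polyOrder (D.p i) := by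
  have hb' : Function.Surjective (aeval (R := F) b) := fun r => by
    obtain ⟨q, rfl⟩ := ha r
    -- Substituting `X ^ t` works because `q(b ^ t) = q(a)`.
    exact ⟨expand F t q, by rw [expand_aeval, ← hab]⟩
  obtain ⟨φ, hφ⟩ := h
  obtain ⟨ψ, hψ⟩ := h'
  beta_reduce at hφ hψ
  have key (i : Fin D.m) : ∃ j, D'.ideal b j = D.ideal a i :=
    RCFData.exists_ideal_eq hψ hb' (RCFData.ideal_isMaximal hφ ha i)
  choose σ hσ using key
  refine ⟨Equiv.ofBijective σ ⟨fun i j hij => ?_, fun j => ?_⟩, fun i => ?_⟩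
  · exact RCFData.ideal_injective hφ ha (by rw [← hσ, hij, hσ])
  · obtain ⟨i, hi⟩ := RCFData.exists_ideal_eq hφ ha (RCFData.ideal_isMaximal hψ hb' j)
    exact ⟨i, RCFData.ideal_injective hψ hb' (by rw [hσ, hi])⟩
  · change D'.e (σ i) = D.e i ∧ polyOrder (D'.p (σ i)) = polyOrder (D.p i)
    constructor
    · refine (D'.e_partition _).eq_of_sum_map_min (D.e_partition _) fun k => ?_
      have h1 := RCFData.finrank_torsion_ideal_pow hφ i k
      -- Both degrees become the dimension of the same residue field, which is then cancelled.
      rw [← hσ, RCFData.finrank_torsion_ideal_pow hψ, ← RCFData.finrank_quotient_ideal hφ ha,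
        ← RCFData.finrank_quotient_ideal hψ hb', hσ] at h1
      refine Nat.eq_of_mul_eq_mul_right ?_ h1
      rw [RCFData.finrank_quotient_ideal hφ ha]
      exact (D.p_irreducible i).natDegree_pos
    · rw [RCFData.polyOrder_eq hφ ha, RCFData.polyOrder_eq hψ hb', hσ]
      congr 1
      ext k
      refine and_congr_right fun _ => ⟨fun h => ?_, fun h => ?_⟩
      · simpa only [← hab] using pow_pow_sub_one_mem t h
      · simpa only [← hb] using pow_pow_sub_one_mem s h

end Invariants

/-! ### Companion matrices as multiplication by the root -/

section Companion

variable {F : Type*} [Field F]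

lemma powerBasisAux'_apply {q : F[X]} (hq : q.Monic) (k : Fin q.natDegree) :
    AdjoinRoot.powerBasisAux' hq k = AdjoinRoot.root q ^ (k : ℕ) :=
  (AdjoinRoot.powerBasis' hq).basis_eq_pow k

/-- Row `i` holds the coordinates of `x ^ (i + 1)` modulo `q`. Since images of basis vectors are
rows here, `A` is studied below through its transpose. -/
lemma repr_root_mul_powerBasisAux' {q : F[X]} (hq : q.Monic) (i j : Fin q.natDegree) :
    (AdjoinRoot.powerBasisAux' hq).repr (AdjoinRoot.root q * AdjoinRoot.powerBasisAux' hq i) j =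
      companionMatrix q i j := by
  rw [powerBasisAux'_apply, ← pow_succ', AdjoinRoot.powerBasisAux'_repr_apply_to_fun,
    ← AdjoinRoot.mk_X, ← map_pow, AdjoinRoot.modByMonicHom_mk, companionMatrix, Matrix.of_apply]
  have hi := i.2
  split_ifs with h1 h2
  · have : X ^ ((i : ℕ) + 1) %ₘ q = X ^ ((i : ℕ) + 1) - q := by
      refine (div_modByMonic_unique 1 _ hq ⟨by ring, ?_⟩).2
      rw [h1]
      refine (degree_sub_lt_left ?_ ?_ ?_).trans_eq ?_
      · rw [degree_X_pow, degree_eq_natDegree hq.ne_zero]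
      · exact pow_ne_zero _ X_ne_zero
      · rw [hq.leadingCoeff, (monic_X_pow _).leadingCoeff]
      · rw [degree_X_pow, degree_eq_natDegree hq.ne_zero]
    rw [this, coeff_sub, coeff_X_pow, if_neg (by omega), zero_sub]
  all_goals
    rw [(modByMonic_eq_self_iff hq).2, coeff_X_pow]
    · simp [h2, eq_comm (a := (j : ℕ))]
    · rw [degree_X_pow, degree_eq_natDegree hq.ne_zero]
      exact_mod_cast (by omega : (i : ℕ) + 1 < q.natDegree)

/-- The basis of the module presented by `D` made of the powers of the roots. -/
noncomputable def RCFData.basis (D : RCFData F) : Module.Basis D.Index F D.Model :=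
  Pi.basis fun b => AdjoinRoot.powerBasisAux' (D.elementaryDivisor_monic b)

/-- Multiplication by `X` on the module presented by `D`. -/
noncomputable def RCFData.mulRoot (D : RCFData F) : D.Model →ₗ[F] D.Model :=
  LinearMap.pi fun b =>
    (LinearMap.mulLeft F (AdjoinRoot.root (D.elementaryDivisor b))).comp (LinearMap.proj b)

lemma RCFData.toMatrix_mulRoot (D : RCFData F) :
    LinearMap.toMatrix D.basis D.basis D.mulRoot = D.matrix.transpose := by
  ext ⟨b, j⟩ ⟨c, i⟩
  rw [LinearMap.toMatrix_apply, RCFData.basis, Pi.basis_repr, Pi.basis_apply, Matrix.transpose_apply,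
    RCFData.matrix, Matrix.blockDiagonal'_apply]
  simp only [RCFData.mulRoot, LinearMap.pi_apply, LinearMap.comp_apply, LinearMap.proj_apply,
    LinearMap.mulLeft_apply]
  split_ifs with h
  · subst h
    rw [Pi.single_eq_same, repr_root_mul_powerBasisAux']
    rfl
  · rw [Pi.single_eq_of_ne' h, mul_zero, map_zero]
    rfl

lemma RCFData.toMatrix_mulRoot_reindex (D : RCFData F) {n : ℕ} (σ : D.Index ≃ Fin n) :
    LinearMap.toMatrix (D.basis.reindex σ) (D.basis.reindex σ) D.mulRoot =
      (Matrix.reindex σ σ D.matrix).transpose := by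
  rw [Matrix.transpose_reindex, ← D.toMatrix_mulRoot]
  ext i j
  simp [LinearMap.toMatrix_apply]

theorem IsRCF.presents {n : ℕ} {A : GL (Fin n) F} {D : RCFData F} (h : IsRCF A D) :
    Presents (fun v => Matrix.mulVec (A : Matrix (Fin n) (Fin n) F).transpose v) D := by
  obtain ⟨σ, L, hL⟩ := h
  have h1 : (A : Matrix (Fin n) (Fin n) F) * L = L * Matrix.reindex σ σ D.matrix := by
    rw [← hL, ← Matrix.GeneralLinearGroup.coe_mul, ← Matrix.GeneralLinearGroup.coe_mul]
    congr 1
    group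
  have h2 := congrArg Matrix.transpose h1
  rw [Matrix.transpose_mul, Matrix.transpose_mul] at h2
  have hLL' : (↑L⁻¹ : Matrix (Fin n) (Fin n) F).transpose *
      (L : Matrix (Fin n) (Fin n) F).transpose = 1 := by
    rw [← Matrix.transpose_mul]
    simp
  have hL'L : (L : Matrix (Fin n) (Fin n) F).transpose *
      (↑L⁻¹ : Matrix (Fin n) (Fin n) F).transpose = 1 := by
    rw [← Matrix.transpose_mul]
    simp
  let φ := (Matrix.toLin'OfInv (M := (↑L⁻¹ : Matrix (Fin n) (Fin n) F).transpose)
    (M' := (L : Matrix (Fin n) (Fin n) F).transpose) hLL' hL'L).trans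
      (D.basis.reindex σ).equivFun.symm
  have hφ (v) : (D.basis.reindex σ).equivFun (φ v) =
      (L : Matrix (Fin n) (Fin n) F).transpose.mulVec v := by
    rw [LinearEquiv.trans_apply, LinearEquiv.apply_symm_apply]
    rfl
  refine ⟨φ, fun v b => ?_⟩
  suffices φ ((A : Matrix (Fin n) (Fin n) F).transpose.mulVec v) = D.mulRoot (φ v) from
    congrFun this b
  apply (D.basis.reindex σ).equivFun.injective
  have h3 := LinearMap.toMatrix_mulVec_repr (D.basis.reindex σ) (D.basis.reindex σ) D.mulRoot (φ v)
  rw [← Module.Basis.equivFun_apply, ← Module.Basis.equivFun_apply, hφ,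
    D.toMatrix_mulRoot_reindex] at h3
  rw [hφ, ← h3, Matrix.mulVec_mulVec, Matrix.mulVec_mulVec, h2]

theorem Presents.isRCF {n : ℕ} {A : GL (Fin n) F} {D : RCFData F}
    (h : Presents (fun v => Matrix.mulVec (A : Matrix (Fin n) (Fin n) F).transpose v) D) :
    IsRCF A D := by
  obtain ⟨φ, hφ⟩ := h
  have hcard : Fintype.card D.Index = Fintype.card (Fin n) := by
    rw [← Module.finrank_eq_card_basis D.basis, ← φ.finrank_eq, Module.finrank_fin_fun,
      Fintype.card_fin]
  let σ := Fintype.equivOfCardEq hcard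
  let ψ := φ.trans (D.basis.reindex σ).equivFun
  let P := LinearMap.toMatrix' ψ.toLinearMap
  let Q := LinearMap.toMatrix' ψ.symm.toLinearMap
  have hPQ : P * Q = 1 := by
    rw [← LinearMap.toMatrix'_comp, LinearEquiv.comp_coe, LinearEquiv.symm_trans_self]
    exact LinearMap.toMatrix'_id
  have hQP : Q * P = 1 := by
    rw [← LinearMap.toMatrix'_comp, LinearEquiv.comp_coe, LinearEquiv.self_trans_symm]
    exact LinearMap.toMatrix'_id
  have hP (v) : P.mulVec v = ψ v := by
    rw [LinearMap.toMatrix'_mulVec]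
    rfl
  have key : P * (A : Matrix (Fin n) (Fin n) F).transpose =
      (Matrix.reindex σ σ D.matrix).transpose * P := by
    refine Matrix.ext_of_mulVec_single fun i => ?_
    rw [← Matrix.mulVec_mulVec, ← Matrix.mulVec_mulVec, hP, hP, ← D.toMatrix_mulRoot_reindex]
    have h3 := LinearMap.toMatrix_mulVec_repr (D.basis.reindex σ) (D.basis.reindex σ) D.mulRoot
      (φ (Pi.single i 1))
    rw [← Module.Basis.equivFun_apply, ← Module.Basis.equivFun_apply] at h3
    refine Eq.trans ?_ h3.symm
    exact congrArg (D.basis.reindex σ).equivFun (funext fun b => hφ _ b)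
  have key' := congrArg Matrix.transpose key
  rw [Matrix.transpose_mul, Matrix.transpose_mul, Matrix.transpose_transpose,
    Matrix.transpose_transpose] at key'
  refine ⟨σ, ⟨P.transpose, Q.transpose, by rw [← Matrix.transpose_mul, hQP, Matrix.transpose_one],
    by rw [← Matrix.transpose_mul, hPQ, Matrix.transpose_one]⟩, ?_⟩
  rw [mul_assoc, Matrix.GeneralLinearGroup.coe_mul, Matrix.GeneralLinearGroup.coe_mul]
  change Q.transpose * (A * P.transpose) = _
  rw [key', ← mul_assoc, ← Matrix.transpose_mul, hPQ, Matrix.transpose_one, one_mul]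

end Companion

/-! ### Existence of a sorted canonical form -/

section Existence

lemma exists_monotone_enum {ι α : Type*} [Finite ι] [LinearOrder α] (key : ι → α) :
    ∃ (m : ℕ) (τ : Fin m ≃ ι), Monotone (key ∘ τ) := by
  obtain ⟨m, ⟨τ⟩⟩ := Finite.exists_equiv_fin ι
  exact ⟨m, (Tuple.sort (key ∘ τ.symm)).trans τ.symm, Tuple.monotone_sort (key ∘ τ.symm)⟩

lemma exists_pairwise_ge_list {ι : Type*} [Finite ι] (e : ι → ℕ) :
    ∃ (l : List ℕ) (τ : Fin l.length ≃ ι), l.Pairwise (· ≥ ·) ∧ ∀ j, l.get j = e (τ j) := by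
  obtain ⟨m, τ, hτ⟩ := exists_monotone_enum (OrderDual.toDual ∘ e)
  refine ⟨List.ofFn (e ∘ τ), (finCongr (List.length_ofFn)).trans τ, ?_, fun j => ?_⟩
  · rw [List.pairwise_ofFn]
    exact fun i j hij => hτ hij.le
  · rw [List.get_ofFn]
    rfl

lemma exists_piEquiv {F ι κ : Type*} [Field F] [Finite κ] {M : ι → Type*} {N : κ → Type*}
    [∀ i, AddCommGroup (M i)] [∀ i, Module F (M i)] [∀ k, AddCommGroup (N k)]
    [∀ k, Module F (N k)] {θ : κ → ι} (hθ : Function.Injective θ)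
    (hM : ∀ i ∉ Set.range θ, Subsingleton (M i)) (f : ∀ k, M (θ k) ≃ₗ[F] N k) :
    ∃ φ : (∀ i, M i) ≃ₗ[F] ∀ k, N k, ∀ w k, φ w k = f k (w (θ k)) := by
  classical
  have := Fintype.ofFinite κ
  let g : (∀ i, M i) →ₗ[F] ∀ k, N k :=
    LinearMap.pi fun k => (f k).toLinearMap.comp (LinearMap.proj (θ k))
  have hg (w k) : g w k = f k (w (θ k)) := rfl
  refine ⟨LinearEquiv.ofBijective g ⟨?_, fun u => ?_⟩, hg⟩
  · rw [← LinearMap.ker_eq_bot, LinearMap.ker_eq_bot']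
    intro w hw
    ext i
    by_cases hi : i ∈ Set.range θ
    · obtain ⟨k, rfl⟩ := hi
      have := congrFun hw k
      rwa [hg, Pi.zero_apply, LinearEquiv.map_eq_zero_iff] at this
    · have := hM i hi
      exact Subsingleton.elim _ _
  · refine ⟨∑ k, Pi.single (θ k) ((f k).symm (u k)), funext fun k => ?_⟩
    rw [hg, Finset.sum_apply, Finset.sum_eq_single k, Pi.single_eq_same,
      LinearEquiv.apply_symm_apply]
    · exact fun j _ hj => Pi.single_eq_of_ne' (hθ.ne hj) _
    · simp

lemma exists_quotientEquiv_adjoinRoot {F : Type*} [Field F] {q g : F[X]} (h : Associated q g) :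
    ∃ κ : (F[X] ⧸ Submodule.span F[X] {q}) ≃ₗ[F] AdjoinRoot g,
      ∀ x, κ ((X : F[X]) • x) = AdjoinRoot.root g * κ x := by
  have hI : Submodule.span F[X] {q} = Ideal.span {g} := Ideal.span_singleton_eq_span_singleton.2 h
  let κ := (Submodule.quotEquivOfEq _ _ hI).restrictScalars F
  refine ⟨κ, fun x => ?_⟩
  obtain ⟨s, rfl⟩ := Submodule.Quotient.mk_surjective _ x
  rfl

/-- The structure theorem gives primary factors in no order, with possibly associated primes and
zero exponents. Zero exponents are trivial factors and are dropped; the rest are grouped by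
normalized prime, then sorted within each group and across groups. -/
theorem exists_presents {F V α : Type*} [Field F] [AddCommGroup V] [Module F V] [Module.Finite F V]
    [LinearOrder α] (key : List ℕ → F[X] → α) (f : Module.End F V) :
    ∃ D : RCFData F, Presents f D ∧ Monotone fun i => key (D.e i) (D.p i) := by
  classical
  have htors : Module.IsTorsion F[X] (Module.AEval' f) :=
    Module.AEval.isTorsion_of_finiteDimensional F V f
  obtain ⟨ι, _, p, hp, e, ⟨l⟩⟩ := Module.equiv_directSum_of_isTorsion htors
  let N (i : {i // e i ≠ 0}) : Set.range fun i : {i // e i ≠ 0} => normalize (p i) :=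
    Set.rangeFactorization _ i
  choose l' τ hl' hτ using fun q => exists_pairwise_ge_list fun i : {i // N i = q} => e i.1
  obtain ⟨m, ρ, hρ⟩ := exists_monotone_enum fun q => key (l' q) q.1
  let D : RCFData F :=
    { m := m
      p := fun i => ρ i
      e := fun i => l' (ρ i)
      p_injective := Subtype.val_injective.comp ρ.injective
      p_monic := fun i => by
        obtain ⟨j, hj⟩ := (ρ i).2
        rw [← hj]
        exact monic_normalize (hp j).ne_zero
      p_irreducible := fun i => by
        obtain ⟨j, hj⟩ := (ρ i).2
        rw [← hj]
        exact (normalize_associated (p j)).symm.irreducible (hp j)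
      e_partition := fun i => by
        refine ⟨?_, fun k hk => ?_, hl' _⟩
        · obtain ⟨j, hj⟩ := (ρ i).2
          rw [← List.length_pos_iff]
          exact ((τ (ρ i)).symm ⟨j, Subtype.ext hj⟩).pos
        · obtain ⟨j, rfl⟩ := List.get_of_mem hk
          rw [hτ]
          exact Nat.pos_of_ne_zero (τ (ρ i) j).1.2 }
  let θ : D.Block ≃ {i // e i ≠ 0} :=
    (Equiv.sigmaCongr ρ fun i => τ (ρ i)).trans (Equiv.sigmaFiberEquiv N)
  have hθe (b : D.Block) : (D.e b.1).get b.2 = e (θ b) := hτ _ _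
  have hθp (b : D.Block) : D.p b.1 = normalize (p (θ b)) :=
    congrArg Subtype.val (τ (ρ b.1) b.2).2.symm
  have hassoc (b : D.Block) : Associated (p (θ b) ^ e (θ b)) (D.elementaryDivisor b) := by
    rw [RCFData.elementaryDivisor, hθe, hθp]
    exact (associated_normalize _).pow_pow
  choose κ hκ using fun b => exists_quotientEquiv_adjoinRoot (hassoc b)
  obtain ⟨φ, hφ⟩ := exists_piEquiv (F := F)
    (M := fun i => F[X] ⧸ Submodule.span F[X] {p i ^ e i})
    (θ := fun b => (θ b).1) (Subtype.val_injective.comp θ.injective) (fun i hi => by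
      have h0 : e i = 0 := by
        by_contra h
        exact hi ⟨θ.symm ⟨i, h⟩, by simp⟩
      rw [Submodule.Quotient.subsingleton_iff, h0, pow_zero]
      exact Ideal.span_singleton_one) κ
  let μ := l.trans (DirectSum.linearEquivFunOnFintype F[X] ι _)
  refine ⟨D, ⟨((Module.AEval'.of f).trans (μ.restrictScalars F)).trans φ, fun v b => ?_⟩, hρ⟩
  rw [LinearEquiv.trans_apply, LinearEquiv.trans_apply, LinearEquiv.trans_apply,
    LinearEquiv.trans_apply, hφ, hφ, ← Module.AEval'.X_smul_of, ← hκ]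
  congr 1
  exact congrFun (map_smul μ (X : F[X]) _) _

end Existence

/-! ### Comparing types of operators that are powers of each other -/

lemma ofFn_eq_ofFn_of_monotone {α : Type*} [LinearOrder α] {m m' : ℕ} {f : Fin m → α}
    {g : Fin m' → α} (hf : Monotone f) (hg : Monotone g) (σ : Fin m ≃ Fin m')
    (h : ∀ i, g (σ i) = f i) : List.ofFn f = List.ofFn g := by
  obtain rfl : m = m' := Fin.equiv_iff_eq.1 ⟨σ⟩
  obtain rfl : g ∘ σ = f := funext h
  exact (Equiv.Perm.ofFn_comp_perm σ g).eq_of_pairwise' hf.sortedLE_ofFn.pairwise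
    hg.sortedLE_ofFn.pairwise

theorem Presents.exists_equiv_of_pow {F V : Type*} [Field F] [AddCommGroup V] [Module F V]
    {f g : Module.End F V} {s t : ℕ} (hg : g = f ^ s) (hf : f = g ^ t) {D D' : RCFData F}
    (h : Presents f D) (h' : Presents g D') :
    ∃ σ : Fin D.m ≃ Fin D'.m, ∀ i,
      D'.e (σ i) = D.e i ∧ polyOrder (D'.p (σ i)) = polyOrder (D.p i) := by
  have := Algebra.isMulCommutative_adjoin F (s := {f}) (by simp)
  let a : Algebra.adjoin F {f} := ⟨f, Algebra.self_mem_adjoin_singleton F f⟩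
  let b : Algebra.adjoin F {f} :=
    ⟨g, by rw [hg]; exact pow_mem (Algebra.self_mem_adjoin_singleton F f) s⟩
  have ha : Function.Surjective (aeval (R := F) a) := by
    rintro ⟨r, hr⟩
    have hr' := hr
    rw [Algebra.adjoin_singleton_eq_range_aeval] at hr'
    obtain ⟨q, rfl⟩ := hr'
    refine ⟨q, Subtype.ext ?_⟩
    exact (aeval_algHom_apply (Algebra.adjoin F {f}).val a q).symm
  exact Presents.exists_equiv (V := V) (a := a) (b := b) (s := s) (t := t)
    (Subtype.ext hg) (Subtype.ext hf) ha h h'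

section MatrixType

variable {F : Type*} [Field F] {n : ℕ}

theorem exists_hasMatrixType (A : GL (Fin n) F) : ∃ T, HasMatrixType A T := by
  obtain ⟨D, hD, hmono⟩ := exists_presents (fun l p => toLex (l, polyOrder p))
    (Matrix.toLin' (A : Matrix (Fin n) (Fin n) F).transpose)
  exact ⟨_, D, hD.isRCF, hmono, rfl⟩

theorem HasMatrixType.eq_of_pow {A B : GL (Fin n) F} {s t : ℕ} (hB : B = A ^ s) (hA : A = B ^ t)
    {T T' : List (List ℕ) × List ℕ} (h : HasMatrixType A T) (h' : HasMatrixType B T') :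
    T = T' := by
  obtain ⟨D, hD, hmono, rfl⟩ := h
  obtain ⟨D', hD', hmono', rfl⟩ := h'
  let f : Module.End F (Fin n → F) := Matrix.toLin' (A : Matrix (Fin n) (Fin n) F).transpose
  let g : Module.End F (Fin n → F) := Matrix.toLin' (B : Matrix (Fin n) (Fin n) F).transpose
  have hg : g = f ^ s := by
    simp only [f, g, hB]
    rw [← Matrix.toLin'_pow, Units.val_pow_eq_pow_val, Matrix.transpose_pow]
  have hf : f = g ^ t := by
    simp only [f, g]
    rw [← Matrix.toLin'_pow, ← Matrix.transpose_pow, ← Units.val_pow_eq_pow_val, ← hA]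
  obtain ⟨σ, hσ⟩ := Presents.exists_equiv_of_pow hg hf hD.presents hD'.presents
  have key := ofFn_eq_ofFn_of_monotone hmono hmono' σ fun i => by
    rw [(hσ i).1, (hσ i).2]
  refine Prod.ext ?_ ?_
  · simpa [List.map_ofFn, Function.comp_def] using congrArg (List.map fun x => (ofLex x).1) key
  · simpa [List.map_ofFn, Function.comp_def] using congrArg (List.map fun x => (ofLex x).2) key

theorem hasMatrixType_matrixType (A : GL (Fin n) F) : HasMatrixType A (matrixType A) :=
  Classical.epsilon_spec (exists_hasMatrixType A)

end MatrixType

end CyclicOrbit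

theorem mainTheorem2 {F : Type*} [Field F] [Finite F] (n : ℕ) :
    -- the matrix type `(e(A), o(A))` is well defined
    (∀ (A : GL (Fin n) F) (T : List (List ℕ) × List ℕ),
      CyclicOrbit.HasMatrixType A T ↔
        T = (CyclicOrbit.typePartitions A, CyclicOrbit.typeOrders A)) ∧
    -- and it agrees for all generators of the same cyclic group
    ∀ A B : GL (Fin n) F, Subgroup.zpowers A = Subgroup.zpowers B →
      CyclicOrbit.typePartitions A = CyclicOrbit.typePartitions B ∧
        CyclicOrbit.typeOrders A = CyclicOrbit.typeOrders B := by
  refine ⟨fun A T => ⟨fun h => ?_, ?_⟩, fun A B h => ?_⟩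
  · exact h.eq_of_pow (pow_one A).symm (pow_one A).symm (CyclicOrbit.hasMatrixType_matrixType A)
  · rintro rfl
    exact CyclicOrbit.hasMatrixType_matrixType A
  -- In a finite group, integer powers are natural powers.
  · obtain ⟨s, hs⟩ : B ∈ Submonoid.powers A := by
      rw [mem_powers_iff_mem_zpowers, h]
      exact Subgroup.mem_zpowers B
    obtain ⟨t, ht⟩ : A ∈ Submonoid.powers B := by
      rw [mem_powers_iff_mem_zpowers, ← h]
      exact Subgroup.mem_zpowers A
    have key := (CyclicOrbit.hasMatrixType_matrixType A).eq_of_pow hs.symm ht.symm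
      (CyclicOrbit.hasMatrixType_matrixType B)
    exact ⟨congrArg Prod.fst key, congrArg Prod.snd key⟩
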